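/- Call a family of sets $S_1,\dots,S_k$ a *$k$-moonflower* if there is a set $I$ such that the sets $S_1\setminus I,\dots,S_k\setminus I$ are all nonempty and pairwise disjoint (equivalently, each $S_i$ contains an element that lies in none of the other $S_j$). A family $\mathcal F$ of sets is *$k$-moonflower-free* if no $k$ of its members form a $k$-moonflower. There exists an absolute constant $C>0$ such that the following holds. Let $k,w\ge 1$ be integers and let $\mathcal F$ be a finite $k$-moonflower-free family of finite sets, each of size at most $w$. Then $$|\mathcal F|\le\begin{cases}\left(C\cdot\frac{k}{w}\right)^{w} & \text{if } w\le k,\\[4pt] \left(C\cdot\frac{w}{k}\right)^{k} & \text{if } w\ge k.\end{cases}$$ In particular, if $w=\Theta(k)$ then $|\mathcal F|\le\exp(O(w))$: for every $A>0$ there is a constant $c>0$, depending only on $A$, such that $|\mathcal F|\le e^{cw}$ for all such $k,w,\mathcal F$ with $w\le Ak$ and $k\le Aw$. -/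

import Mathlib

universe u

/-- The sets `S₁, …, S_k` form a `k`-moonflower: for some set `I`, the sets `S_i \ I` are all
nonempty and pairwise disjoint. -/
def IsMoonflower {α : Type*} [DecidableEq α] {k : ℕ} (S : Fin k → Finset α) : Prop :=
  ∃ I : Finset α, (∀ i, (S i \ I).Nonempty) ∧ ∀ i j, i ≠ j → Disjoint (S i \ I) (S j \ I)

/-- A family of sets is `k`-moonflower-free if no `k` of its members form a `k`-moonflower. (The
members of a moonflower are automatically distinct.) -/
def MoonflowerFree {α : Type*} [DecidableEq α] (k : ℕ) (F : Finset (Finset α)) : Prop :=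
  ∀ S : Fin k → Finset α, (∀ i, S i ∈ F) → ¬ IsMoonflower S

/-- A family of `w`-sets, that is, of sets of size at most `w`. -/
def IsFamilyOfWSets {α : Type*} (w : ℕ) (F : Finset (Finset α)) : Prop :=
  ∀ S ∈ F, S.card ≤ w

/-! Order the members by size, so that no later one lies inside an earlier one. For each `S i`, a
minimal set `T i` avoiding `S i` and meeting all later members has fewer than `k` elements: by
minimality each of its points has a private member, and these would form a moonflower. The skew
Bollobás inequality then bounds the family by a binomial coefficient. That inequality is a rank
bound: with `p j` vanishing exactly on the labels of `S j`, the matrix of products of `p j` over `T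
i` is triangular and factors through degree-`d` monomials in `w + 1` coefficients. -/

open Finset in
/-- A product of `d` evaluations of a polynomial of degree at most `w` factors through the
monomials of degree `d` in its `w + 1` coefficients. -/
theorem prod_eval_eq_sum_sym (w d : ℕ) (τ : Fin d → ℚ) :
    ∃ a : Sym (Fin (w + 1)) d → ℚ, ∀ p : Polynomial ℚ, p.natDegree ≤ w →
      ∏ l, p.eval (τ l) =
        ∑ m, a m * (((m : Multiset (Fin (w + 1))).map fun i : Fin (w + 1) => p.coeff i).prod) := by
  classical
  let g : (Fin d → Fin (w + 1)) → Sym (Fin (w + 1)) d := fun φ =>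
    ⟨(univ : Finset (Fin d)).val.map φ, by simp⟩
  refine ⟨fun m => ∑ φ with g φ = m, ∏ l, τ l ^ (φ l : ℕ), fun p hp => ?_⟩
  have h1 : ∀ x : ℚ, p.eval x = ∑ i : Fin (w + 1), p.coeff i * x ^ (i : ℕ) := fun x => by
    rw [p.eval_eq_sum_range' (Nat.lt_succ_of_le hp),
      ← Fin.sum_univ_eq_sum_range (fun i => p.coeff i * x ^ i)]
  simp_rw [h1, Finset.prod_univ_sum, Fintype.piFinset_univ, Finset.sum_mul]
  rw [← Finset.sum_fiberwise (univ : Finset (Fin d → Fin (w + 1))) g]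
  refine Finset.sum_congr rfl fun m _ => Finset.sum_congr rfl fun φ hφ => ?_
  obtain rfl : g φ = m := (Finset.mem_filter.1 hφ).2
  rw [Finset.prod_mul_distrib, mul_comm]
  congr 1
  simp only [g, Sym.coe_mk, Multiset.map_map, Finset.prod, Function.comp_def]

/-- A finite set of size at most `d`, whose elements are labelled by naturals, is listed by a
`d`-tuple of labels padded with `-1`. -/
theorem exists_padded_labels {α : Type*} (f : α → ℕ) (T : Finset α) {d : ℕ} (hT : T.card ≤ d) :
    ∃ τ : Fin d → ℚ, (∀ t ∈ T, ∃ l, τ l = f t) ∧ ∀ l, τ l = -1 ∨ ∃ t ∈ T, τ l = f t := by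
  refine ⟨fun l => if h : (l : ℕ) < T.card then f (T.equivFin.symm ⟨l, h⟩) else -1, ?_, ?_⟩
  · intro t ht
    refine ⟨⟨T.equivFin ⟨t, ht⟩, (T.equivFin ⟨t, ht⟩).2.trans_le hT⟩, ?_⟩
    simp
  · intro l
    by_cases h : (l : ℕ) < T.card
    · exact Or.inr ⟨T.equivFin.symm ⟨l, h⟩, Finset.coe_mem _, by simp [h]⟩
    · exact Or.inl (by simp [h])

/-- The skew Bollobás set-pair inequality. -/
theorem card_le_choose_of_skew_pairs {α : Type*} {n w d : ℕ}
    (S T : Fin n → Finset α) (hS : ∀ i, (S i).card ≤ w) (hT : ∀ i, (T i).card ≤ d)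
    (hdisj : ∀ i, ∀ x ∈ S i, x ∉ T i) (hmeet : ∀ i j, i < j → ∃ x ∈ S j, x ∈ T i) :
    n ≤ (w + d).choose d := by
  classical
  set U : Finset α := Finset.univ.biUnion S ∪ Finset.univ.biUnion T with hU
  have hSU : ∀ i, ∀ x ∈ S i, x ∈ (U : Set α) := fun i x hx => by
    simp only [hU, Finset.mem_coe, Finset.mem_union, Finset.mem_biUnion, Finset.mem_univ, true_and]
    exact Or.inl ⟨i, hx⟩
  have hTU : ∀ i, ∀ x ∈ T i, x ∈ (U : Set α) := fun i x hx => by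
    simp only [hU, Finset.mem_coe, Finset.mem_union, Finset.mem_biUnion, Finset.mem_univ, true_and]
    exact Or.inr ⟨i, hx⟩
  obtain ⟨f, hf⟩ := Set.countable_iff_exists_injOn.1 (U : Set α).toFinite.countable
  choose τ hτ₁ hτ₂ using fun i => exists_padded_labels f (T i) (hT i)
  choose a ha using fun i => prod_eval_eq_sum_sym w d (τ i)
  let p : Fin n → Polynomial ℚ := fun j =>
    ∏ s ∈ S j, (Polynomial.X - Polynomial.C (f s : ℚ))
  have hp : ∀ j, (p j).natDegree ≤ w := fun j => by
    rw [Polynomial.natDegree_finsetProd_X_sub_C_eq_card]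
    exact hS j
  have heval : ∀ j x, (p j).eval x = ∏ s ∈ S j, (x - (f s : ℚ)) := fun j x => by
    simp [p, Polynomial.eval_prod]
  let A : Matrix (Fin n) (Sym (Fin (w + 1)) d) ℚ := Matrix.of a
  let B : Matrix (Sym (Fin (w + 1)) d) (Fin n) ℚ := Matrix.of fun m j =>
    ((m : Multiset (Fin (w + 1))).map fun i : Fin (w + 1) => (p j).coeff i).prod
  have hAB : ∀ i j, (A * B) i j = ∏ l, (p j).eval (τ i l) := fun i j => by
    rw [ha i (p j) (hp j), Matrix.mul_apply]
    rfl
  have htri : (A * B).BlockTriangular OrderDual.toDual := fun i j hij => by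
    obtain ⟨x, hxS, hxT⟩ := hmeet i j (OrderDual.toDual_lt_toDual.1 hij)
    obtain ⟨l, hl⟩ := hτ₁ i x hxT
    rw [hAB]
    refine Finset.prod_eq_zero (Finset.mem_univ l) ?_
    rw [heval]
    exact Finset.prod_eq_zero hxS (by rw [hl, sub_self])
  have hdet : (A * B).det ≠ 0 := by
    rw [Matrix.det_of_isLowerTriangular _ htri, Finset.prod_ne_zero_iff]
    intro i _
    rw [hAB, Finset.prod_ne_zero_iff]
    intro l _
    rw [heval, Finset.prod_ne_zero_iff]
    intro s hs h
    -- The padding value `-1` is never a root, since all roots of `p i` are naturals.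
    rcases hτ₂ i l with h' | ⟨t, ht, h'⟩
    · have : (0 : ℚ) ≤ f s := Nat.cast_nonneg _
      linarith
    · have hst : f s = f t := by
        have : (f t : ℚ) = f s := by linarith
        exact_mod_cast this.symm
      exact hdisj i s hs (hf (hSU i s hs) (hTU i t ht) hst ▸ ht)
  have hrank : (A * B).rank = n := by
    rw [Matrix.rank_of_isUnit _ ((Matrix.isUnit_iff_isUnit_det _).2 hdet.isUnit), Fintype.card_fin]
  have h := (Matrix.rank_mul_le_left A B).trans A.rank_le_card_width
  rw [hrank, Sym.card_sym_eq_multichoose, Fintype.card_fin, Nat.multichoose_eq] at h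
  rwa [show w + 1 + d - 1 = w + d by omega] at h

/-- In a moonflower-free family, the members not contained in `S` have a transversal of size less
than `k` disjoint from `S`. -/
theorem MoonflowerFree.exists_transversal {α : Type*} [DecidableEq α] {k : ℕ}
    {F G : Finset (Finset α)} (hF : MoonflowerFree k F) (hG : G ⊆ F) (S : Finset α)
    (hS : ∀ R ∈ G, ¬ R ⊆ S) :
    ∃ T : Finset α, T.card < k ∧ (∀ x ∈ S, x ∉ T) ∧ ∀ R ∈ G, ∃ x ∈ R, x ∈ T := by
  let P : Finset α → Prop := fun T => (∀ x ∈ S, x ∉ T) ∧ ∀ R ∈ G, ∃ x ∈ R, x ∈ T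
  have hP : P (F.biUnion id \ S) := by
    refine ⟨fun x hx h => (Finset.mem_sdiff.1 h).2 hx, fun R hR => ?_⟩
    obtain ⟨x, hxR, hxS⟩ := Finset.not_subset.1 (hS R hR)
    exact ⟨x, hxR, Finset.mem_sdiff.2 ⟨Finset.mem_biUnion.2 ⟨R, hG hR, hxR⟩, hxS⟩⟩
  obtain ⟨T, -, hT⟩ := exists_minimal_le_of_wellFoundedLT P _ hP
  refine ⟨T, ?_, hT.prop.1, hT.prop.2⟩
  by_contra! hk
  have hpriv : ∀ t ∈ T, ∃ R ∈ G, ∀ x, x ∈ R ∧ x ∈ T ↔ x = t := by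
    intro t ht
    by_contra! hcon
    have hPe : P (T.erase t) := by
      refine ⟨fun x hx h => hT.prop.1 x hx (Finset.mem_of_mem_erase h), fun R hR => ?_⟩
      by_contra! hno
      obtain ⟨y, hyR, hyT⟩ := hT.prop.2 R hR
      have honly : ∀ x ∈ R, x ∈ T → x = t := fun x hxR hxT => by
        by_contra hne
        exact hno x hxR (Finset.mem_erase.2 ⟨hne, hxT⟩)
      obtain rfl := honly y hyR hyT
      obtain ⟨x, hx⟩ := hcon R hR
      rcases hx with ⟨⟨h1, h2⟩, h3⟩ | ⟨h1, h2⟩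
      · exact h3 (honly x h1 h2)
      · exact h1 (h2 ▸ hyR) (h2 ▸ hyT)
    exact Finset.notMem_erase t T (hT.le_of_le hPe (Finset.erase_subset t T) ht)
  choose! R hRG hR using hpriv
  let e : Fin k → α := fun l => T.equivFin.symm (Fin.castLE hk l)
  have heT : ∀ l, e l ∈ T := fun l => Finset.coe_mem _
  have hinj : Function.Injective e := fun l l' h =>
    Fin.castLE_injective hk (T.equivFin.symm.injective (Subtype.ext h))
  -- Taking everything outside `T` as the kernel shrinks each private member to its own point.
  have hsd : ∀ l, R (e l) \ (F.biUnion id \ T) = {e l} := fun l => by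
    ext x
    rw [Finset.mem_singleton, ← hR (e l) (heT l) x, Finset.mem_sdiff, Finset.mem_sdiff]
    constructor
    · rintro ⟨h1, h2⟩
      refine ⟨h1, ?_⟩
      by_contra h3
      exact h2 ⟨Finset.mem_biUnion.2 ⟨_, hG (hRG _ (heT l)), h1⟩, h3⟩
    · rintro ⟨h1, h2⟩
      exact ⟨h1, fun h => h.2 h2⟩
  refine hF (fun l => R (e l)) (fun l => hG (hRG _ (heT l))) ⟨F.biUnion id \ T, ?_, ?_⟩
  · intro l
    rw [hsd]
    exact Finset.singleton_nonempty _
  · intro l l' hll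
    rw [hsd, hsd, Finset.disjoint_singleton]
    exact fun h => hll (hinj h)

/-- A `k`-moonflower-free family of `w`-sets has at most `(w + k - 1).choose (k - 1)` members. -/
theorem MoonflowerFree.card_le_choose {α : Type*} [DecidableEq α] {k w : ℕ}
    {F : Finset (Finset α)} (hF : MoonflowerFree k F) (hw : IsFamilyOfWSets w F) :
    F.card ≤ (w + (k - 1)).choose (k - 1) := by
  let S₀ : Fin F.card → Finset α := fun i => F.equivFin.symm i
  let σ := Tuple.sort fun i => (S₀ i).card
  let S : Fin F.card → Finset α := fun i => S₀ (σ i)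
  have hmono : Monotone fun i => (S i).card := Tuple.monotone_sort fun i => (S₀ i).card
  have hSF : ∀ i, S i ∈ F := fun i => Finset.coe_mem _
  have hinj : Function.Injective S := fun i j h =>
    σ.injective (F.equivFin.symm.injective (Subtype.ext h))
  have hT : ∀ i, ∃ T : Finset α, T.card < k ∧ (∀ x ∈ S i, x ∉ T) ∧
      ∀ R ∈ (Finset.Ioi i).image S, ∃ x ∈ R, x ∈ T := fun i => by
    refine hF.exists_transversal ?_ (S i) ?_
    · exact Finset.image_subset_iff.2 fun j _ => hSF j
    · intro R hR hsub
      obtain ⟨j, hj, rfl⟩ := Finset.mem_image.1 hR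
      have hij := Finset.mem_Ioi.1 hj
      exact hij.ne' (hinj (Finset.eq_of_subset_of_card_le hsub (hmono hij.le)))
  choose T hTk hTS hTR using hT
  exact card_le_choose_of_skew_pairs S T (fun i => hw _ (hSF i))
    (fun i => Nat.le_sub_one_of_lt (hTk i)) hTS
    fun i j hij => hTR i _ (Finset.mem_image_of_mem S (Finset.mem_Ioi.2 hij))

theorem choose_le_exp_mul_div_pow (n : ℕ) {r : ℕ} (hr : 1 ≤ r) :
    (n.choose r : ℝ) ≤ (Real.exp 1 * ((n : ℝ) / r)) ^ r := by
  have hr' : (0 : ℝ) < r := by exact_mod_cast hr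
  have h2 := Real.pow_div_factorial_le_exp (r : ℝ) hr'.le r
  calc (n.choose r : ℝ) ≤ (n : ℝ) ^ r / r.factorial := Nat.choose_le_pow_div r n
    _ = ((n : ℝ) / r) ^ r * ((r : ℝ) ^ r / r.factorial) := by
      rw [div_pow]; field_simp
    _ ≤ ((n : ℝ) / r) ^ r * Real.exp r := by gcongr
    _ = (Real.exp 1 * ((n : ℝ) / r)) ^ r := by
      rw [mul_pow, ← Real.exp_nat_mul, mul_one, mul_comm]

theorem choose_add_le_pow {r s : ℕ} (hr : 1 ≤ r) (hrs : r ≤ s) :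
    ((r + s).choose r : ℝ) ≤ (2 * Real.exp 1 * ((s : ℝ) / r)) ^ r := by
  have hrs' : (r : ℝ) ≤ s := by exact_mod_cast hrs
  refine (choose_le_exp_mul_div_pow (r + s) hr).trans ?_
  have : Real.exp 1 * (((r + s : ℕ) : ℝ) / r) ≤ Real.exp 1 * ((2 * s : ℝ) / r) := by
    push_cast
    gcongr
    linarith
  calc _ ≤ (Real.exp 1 * ((2 * s : ℝ) / r)) ^ r := by gcongr
    _ = _ := by ring

theorem MoonflowerFree.card_le_pow {α : Type*} [DecidableEq α] {k w : ℕ} (hk : 1 ≤ k)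
    (hw : 1 ≤ w) {F : Finset (Finset α)} (hFw : IsFamilyOfWSets w F) (hF : MoonflowerFree k F) :
    (w ≤ k → (F.card : ℝ) ≤ (2 * Real.exp 1 * ((k : ℝ) / (w : ℝ))) ^ w) ∧
      (k ≤ w → (F.card : ℝ) ≤ (2 * Real.exp 1 * ((w : ℝ) / (k : ℝ))) ^ k) := by
  -- Weakened by Pascal's rule to a bound symmetric in `k` and `w`, so one estimate serves both
  -- regimes.
  have h : F.card ≤ (k + w).choose k := by
    refine (hF.card_le_choose hFw).trans ?_
    obtain ⟨k, rfl⟩ := Nat.exists_eq_add_of_le' hk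
    rw [show k + 1 + w = (w + k) + 1 by ring, Nat.choose_succ_succ]
    exact Nat.le_add_right _ _
  refine ⟨fun hwk => ?_, fun hkw => ?_⟩
  · rw [Nat.choose_symm_add, add_comm] at h
    exact (Nat.cast_le.2 h).trans (choose_add_le_pow hw hwk)
  · exact (Nat.cast_le.2 h).trans (choose_add_le_pow hk hkw)

theorem pow_le_exp_mul {x : ℝ} (hx : 0 ≤ x) (n : ℕ) : x ^ n ≤ Real.exp (x * n) := by
  rw [mul_comm, Real.exp_nat_mul]
  have := Real.add_one_le_exp x
  gcongr
  linarith

theorem theorem1p3 :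
    (∃ C : ℝ, 0 < C ∧
      ∀ (α : Type u) [DecidableEq α] (k w : ℕ), 1 ≤ k → 1 ≤ w →
        ∀ F : Finset (Finset α), IsFamilyOfWSets w F → MoonflowerFree k F →
          (w ≤ k → (F.card : ℝ) ≤ (C * ((k : ℝ) / (w : ℝ))) ^ w) ∧
          (k ≤ w → (F.card : ℝ) ≤ (C * ((w : ℝ) / (k : ℝ))) ^ k)) ∧
    (∀ A : ℝ, 0 < A → ∃ c : ℝ, 0 < c ∧
      ∀ (α : Type u) [DecidableEq α] (k w : ℕ), 1 ≤ k → 1 ≤ w →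
        (w : ℝ) ≤ A * (k : ℝ) → (k : ℝ) ≤ A * (w : ℝ) →
        ∀ F : Finset (Finset α), IsFamilyOfWSets w F → MoonflowerFree k F →
          (F.card : ℝ) ≤ Real.exp (c * (w : ℝ))) := by
  refine ⟨⟨2 * Real.exp 1, by positivity, fun α _ k w hk hw F hFw hF =>
    hF.card_le_pow hk hw hFw⟩, fun A hA => ?_⟩
  -- The first summand covers `w ≤ k`, using `k ≤ A * w`; the second covers `k ≤ w`.
  refine ⟨2 * Real.exp 1 * A + 2 * Real.exp 1, by positivity, ?_⟩
  intro α _ k w hk hw _ hkA F hFw hF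
  have hk' : (0 : ℝ) < k := by exact_mod_cast hk
  have hw' : (0 : ℝ) < w := by exact_mod_cast hw
  have hC : (0 : ℝ) < 2 * Real.exp 1 := by positivity
  obtain ⟨h₁, h₂⟩ := hF.card_le_pow hk hw hFw
  rcases le_total w k with h | h
  · refine ((h₁ h).trans (pow_le_exp_mul (by positivity) w)).trans (Real.exp_le_exp.2 ?_)
    have : 2 * Real.exp 1 * ((k : ℝ) / w) * w = 2 * Real.exp 1 * k := by field_simp
    rw [this]
    nlinarith [mul_le_mul_of_nonneg_left hkA hC.le, mul_pos hC hw']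
  · refine ((h₂ h).trans (pow_le_exp_mul (by positivity) k)).trans (Real.exp_le_exp.2 ?_)
    have : 2 * Real.exp 1 * ((w : ℝ) / k) * k = 2 * Real.exp 1 * w := by field_simp
    rw [this]
    nlinarith [mul_pos (mul_pos hC hA) hw']
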